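/- Work in the Euclidean plane with coordinates $(x_P,y_P)$ of a point $P$. A \emph{Harborth configuration} consists of points $A,B,C,D,E,F,G,H,J$ such that (i) $A=(0,0)$, $C$ lies on the positive $x$-axis, $T:=y_B\ge 0$, and $|AB|=|BC|=1$; (ii) $BCDE$ is the symmetric trapezoid, with vertices in counterclockwise order (so that for $T>0$ it lies on the other side of $BC$ than $A$), with parallel sides $|CD|=3$, $|BE|=2$, angle $60^\circ$ at $C$ and angle $120^\circ$ at $B$; (iii) $|FA|=|FE|=1$ and the quadrangle $ABEF$ is convex, with vertices in counterclockwise order (straight angles being allowed); (iv) $|GF|=1$, $|GD|=2$, and $G$ lies to the left of (or on) the directed line from $F$ to $D$; (v) $|HD|=|HG|=2$, and $H$ lies to the left of the directed line from $G$ to $D$, i.e. on the side not containing $F$; (vi) $|JF|=|JG|=1$, and $J$ lies to the left of the directed line from $F$ to $G$, i.e. on the side not containing $D$. The points $A,\dots,H,J$ are the corresponding vertices of (one quarter of) the Harborth graph when, moreover, the line $HJ$ is perpendicular to the line $AC$, i.e. $x_H=x_J$. The \emph{minimal polynomial} of an algebraic real number $y$ is the primitive integer polynomial with positive leading coefficient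 and of smallest degree among the nonzero integer polynomials that vanish at $y$. \textbf{Theorem.} Harborth configurations with $x_H=x_J$ exist, and in every such configuration the minimal polynomials of the $y$-coordinates $y_G$, $y_H$, $y_J$ of the vertices $G$, $H$, $J$ are, respectively, $$\begin{aligned}P_{y_G}(y)={}&-912811377667500 + 16117998953248125 y^{2} - 36709013218422600 y^{4} + 37940201286814800 y^{6} - 23463887481854208 y^{8}\\& + 10021184125203456 y^{10} - 3290335763447808 y^{12} + 888521341648896 y^{14} - 192809455583232 y^{16}\\& + 29839017902080 y^{18} - 2742026240000 y^{20} + 109337116672 y^{22},\end{aligned}$$ $$\begin{aligned}P_{y_H}(y)={}&-12148787578527675 - 123412000423046805 y^{2} - 441020584930952232 y^{4} + 273168911377174014 y^{6} - 27343071784237320 y^{8}\\& - 3667116898760364 y^{10} + 823044986987616 y^{12} - 32095868573376 y^{14} - 4779985142784 y^{16}\\& + 615643279360 y^{18} - 27098808320 y^{20} + 427098112 y^{22},\end{aligned}$$ $$\begin{aligned}P_{y_J}(y)={}&-9964518750000 + 570277711828125 y^{2} - 1780552966387500 y^{4} + 849106838377800 y^{6} + 644904447905880 y^{8}\\& - 102048280254828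 y^{10} - 56106534718368 y^{12} + 9027433758528 y^{14} + 605520976896 y^{16}\\& - 103349145600 y^{18} - 2815229952 y^{20} + 427098112 y^{22}.\end{aligned}$$ -/

import Mathlib

open scoped Polynomial

namespace Harborth

/-- The Euclidean plane; `P 0` and `P 1` are the `x`- and the `y`-coordinate of `P`. -/
abbrev Plane := EuclideanSpace ℝ (Fin 2)

/-- Twice the signed area of the triangle `P Q R`: it is positive exactly when `R` lies strictly
to the left of the line from `P` to `Q`, and zero exactly when the points are collinear. -/
def orient (P Q R : Plane) : ℝ :=
  (Q 0 - P 0) * (R 1 - P 1) - (Q 1 - P 1) * (R 0 - P 0)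

/-- `P Q R S` is a convex quadrangle, its vertices being listed counterclockwise
(straight angles are allowed). -/
def IsConvexQuadrangle (P Q R S : Plane) : Prop :=
  0 ≤ orient P Q R ∧ 0 ≤ orient Q R S ∧ 0 ≤ orient R S P ∧ 0 ≤ orient S P Q

/-- The points `A, …, H, J` form a Harborth configuration, in coordinates with origin `A` in which
the ray from `A` through `C` is the positive `x`-axis. The height `T` of the initial triangle, that
is the `y`-coordinate of `B`, is an arbitrary nonnegative number. -/
structure IsConfiguration (A B C D E F G H J : Plane) : Prop where
  /-- The origin of the coordinate system. -/
  origin : A = 0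
  /-- `C` lies on the `x`-axis. -/
  axis : C 1 = 0
  /-- `C` lies on the positive half of the axis. -/
  axis_pos : 0 < C 0
  /-- The height of the triangle `A B C` is nonnegative. -/
  height : 0 ≤ B 1
  /-- `A B C` is isosceles with sides `AB` and `BC` of unit length. -/
  side_AB : dist A B = 1
  side_BC : dist B C = 1
  /-- `B C D E` is the symmetric trapezoid on the side `BC`, facing away from `A`, with parallel
  sides `CD` of length `3` and `BE` of length `2`; its angle at `C` is `60°` and its angle at `B`
  is `120°`. -/
  side_CD : dist C D = 3
  angle_C : inner ℝ (B - C) (D - C) = 3 / 2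
  side_BE : dist B E = 2
  angle_B : inner ℝ (C - B) (E - B) = -1
  trapezoid : IsConvexQuadrangle B C D E
  /-- `F` is the point of intersection for which the quadrangle `A B E F` is convex. -/
  mem_F : F ∈ Metric.sphere A 1 ∩ Metric.sphere E 1
  side_F : IsConvexQuadrangle A B E F
  /-- `G` is the point of intersection on the left of the line from `F` to `D`. -/
  mem_G : G ∈ Metric.sphere F 1 ∩ Metric.sphere D 2
  side_G : 0 ≤ orient F D G
  /-- `H` is the point of intersection on the left of the line from `G` to `D`, the side of
  that line not containing `F`. -/
  mem_H : H ∈ Metric.sphere D 2 ∩ Metric.sphere G 2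
  side_H : 0 ≤ orient G D H
  /-- `J` is the point of intersection on the left of the line from `F` to `G`, the side of
  that line not containing `D`. -/
  mem_J : J ∈ Metric.sphere F 1 ∩ Metric.sphere G 1
  side_J : 0 ≤ orient F G J

/-- The points `A, …, H, J` are the corresponding vertices of the Harborth graph: they form a
Harborth configuration in which the line `HJ` is perpendicular to `AC`, the condition under which
the configuration, being one quarter of the graph, is completed by reflections to the graph. -/
structure IsHarborth (A B C D E F G H J : Plane) : Prop
    extends IsConfiguration A B C D E F G H J where
  perp : H 0 = J 0

/-- `P` is the minimal polynomial over `ℤ` of the real number `y`: the primitive integer polynomial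
with positive leading coefficient, of least degree among the nonzero integer polynomials that
vanish at `y`. -/
structure IsMinimalPolynomial (P : ℤ[X]) (y : ℝ) : Prop where
  primitive : P.IsPrimitive
  leadingCoeff_pos : 0 < P.leadingCoeff
  root : Polynomial.aeval y P = 0
  minimal : ∀ Q : ℤ[X], Q ≠ 0 → Polynomial.aeval y Q = 0 → P.natDegree ≤ Q.natDegree

/-- The polynomial `P_{y_G}`. -/
noncomputable def polyG : ℤ[X] :=
  -912811377667500 + 16117998953248125 * Polynomial.X ^ 2
    - 36709013218422600 * Polynomial.X ^ 4 + 37940201286814800 * Polynomial.X ^ 6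
    - 23463887481854208 * Polynomial.X ^ 8 + 10021184125203456 * Polynomial.X ^ 10
    - 3290335763447808 * Polynomial.X ^ 12 + 888521341648896 * Polynomial.X ^ 14
    - 192809455583232 * Polynomial.X ^ 16 + 29839017902080 * Polynomial.X ^ 18
    - 2742026240000 * Polynomial.X ^ 20 + 109337116672 * Polynomial.X ^ 22

/-- The polynomial `P_{y_H}`. -/
noncomputable def polyH : ℤ[X] :=
  -12148787578527675 - 123412000423046805 * Polynomial.X ^ 2
    - 441020584930952232 * Polynomial.X ^ 4 + 273168911377174014 * Polynomial.X ^ 6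
    - 27343071784237320 * Polynomial.X ^ 8 - 3667116898760364 * Polynomial.X ^ 10
    + 823044986987616 * Polynomial.X ^ 12 - 32095868573376 * Polynomial.X ^ 14
    - 4779985142784 * Polynomial.X ^ 16 + 615643279360 * Polynomial.X ^ 18
    - 27098808320 * Polynomial.X ^ 20 + 427098112 * Polynomial.X ^ 22

/-- The polynomial `P_{y_J}`. -/
noncomputable def polyJ : ℤ[X] :=
  -9964518750000 + 570277711828125 * Polynomial.X ^ 2
    - 1780552966387500 * Polynomial.X ^ 4 + 849106838377800 * Polynomial.X ^ 6
    + 644904447905880 * Polynomial.X ^ 8 - 102048280254828 * Polynomial.X ^ 10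
    - 56106534718368 * Polynomial.X ^ 12 + 9027433758528 * Polynomial.X ^ 14
    + 605520976896 * Polynomial.X ^ 16 - 103349145600 * Polynomial.X ^ 18
    - 2815229952 * Polynomial.X ^ 20 + 427098112 * Polynomial.X ^ 22

end Harborth

/-!
In the coordinates `ξ = x / (√3 β)`, `υ = y / β`, where `√3 β` is half the length of `A C`,
rotations by `60°` are rational, and a configuration is determined by the height `r` of `B` and
the signed distance `η ≥ 0` of `F` from the line `A E` (both suitably scaled), with a quadratic
equation `4 (9 + 12 r + 7 r²) η² = 1 - 4 r - r²`. The triangles `G D H` and `F G J` being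
equilateral, the condition `x_H = x_J` says that the ordinate of `G` is a linear function of the
coordinates of the other points. Then the difference of the two circle equations for `G`
determines the abscissa of `G`, and the remaining equation is one between `r` and `η`
(`elimination_identity`). Modulo the quadratic equation it is linear in `η`, so `η` is a rational
function of `r` (`Params.eta`), and substitution into the quadratic equation gives `(3 + r²) (3 +
r) polyR(r) = 0` with a polynomial `polyR` of degree `11` (`Params.eval_polyR`); the first two
factors are positive.

Hence `y_G² / β²`, `y_H² / β²`, `y_J² / β²` and `β² = 1 / (3 + r²)` are rational functions of the
root `r` of `polyR`. That the three polynomials vanish at the three ordinates means that `polyR`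
divides the numerators that result from the substitution of these rational functions
(`Params.eval_sq_eq_zero`). The divisions are carried out on lists of integer coefficients.

The polynomials have degree `22` and are polynomials in `y²`. They remain irreducible modulo `31`:
on their roots the eleventh power of the Frobenius map is `α ↦ -α`, and the squares of the roots
are not in the prime field (`irreducible_of_frobenius_pow_eq_neg`,
`CoeffList.irreducible_eval_expandTwo`). A primitive irreducible integer polynomial is the minimal
polynomial of its roots.

Conversely, `polyR` has a root between `1 / 5` and `11 / 50`. The formulas for `η` and for the
points then give a configuration, and rough bounds for `r` and `η` suffice for all conditions on
the position of the points (`exists_isHarborth`).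
-/

namespace Harborth

/-! ### Polynomials as lists of integers -/

namespace CoeffList

/-- The value at `x` of the polynomial with the list `l` of coefficients, constant term first. -/
def eval {R : Type*} [CommRing R] (x : R) : List ℤ → R
  | [] => 0
  | c :: l => c + x * eval x l

/-- Sum of polynomials. -/
def add : List ℤ → List ℤ → List ℤ
  | [], m => m
  | l, [] => l
  | c :: l, d :: m => (c + d) :: add l m

/-- Multiplication of a polynomial by an integer. -/
def smul (a : ℤ) (l : List ℤ) : List ℤ := l.map (a * ·)

/-- Product of polynomials. -/
def mul : List ℤ → List ℤ → List ℤ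
  | [], _ => []
  | c :: l, m => add (smul c m) (0 :: mul l m)

/-- The polynomial `l (X ^ 2)`. -/
def expandTwo : List ℤ → List ℤ
  | [] => []
  | c :: l => c :: 0 :: expandTwo l

/-- Horner's rule for the value of `l = ∑ cᵢ Xⁱ` at a fraction `a / b` of polynomials: for a list of
length `n` the result is the pair of `∑ cᵢ aⁱ bⁿ⁻ⁱ` and `bⁿ`. -/
def homEval (a b : List ℤ) : List ℤ → List ℤ × List ℤ
  | [] => ([], [1])
  | c :: l =>
    let t := homEval a b l
    let d := mul b t.2
    (add (smul c d) (mul a t.1), d)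

/-- At most `n` steps of the long division, from the constant terms upwards, of a polynomial by
`p₀ + X * p`. -/
def quot (p₀ : ℤ) (p : List ℤ) : ℕ → List ℤ → List ℤ
  | 0, _ => []
  | _, [] => []
  | n + 1, c :: a => c / p₀ :: quot p₀ p n (add a (smul (-(c / p₀)) p))

/-- The test whether `l` is the product of `p` and the quotient computed by `quot`. -/
def divides (p l : List ℤ) : Bool :=
  (add l (smul (-1) (mul (quot (p.headD 0) p.tail l.length l) p))).all (· == 0)

section CommRing

variable {R : Type*} [CommRing R] (x : R)

@[simp] lemma eval_nil : eval x [] = 0 := rfl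

@[simp] lemma eval_cons (c : ℤ) (l : List ℤ) : eval x (c :: l) = c + x * eval x l := rfl

@[simp] lemma eval_add (l m : List ℤ) : eval x (add l m) = eval x l + eval x m := by
  induction l generalizing m with
  | nil => simp [add]
  | cons c l ih =>
    cases m with
    | nil => simp [add]
    | cons d m => simp only [add, eval_cons, ih]; push_cast; ring

@[simp] lemma eval_smul (a : ℤ) (l : List ℤ) : eval x (smul a l) = a * eval x l := by
  induction l with
  | nil => simp [smul]
  | cons c l ih =>
    simp only [smul, List.map_cons, eval_cons] at ih ⊢
    rw [ih]
    push_cast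
    ring

@[simp] lemma eval_mul (l m : List ℤ) : eval x (mul l m) = eval x l * eval x m := by
  induction l with
  | nil => simp [mul]
  | cons c l ih => simp only [mul, eval_add, eval_smul, eval_cons, ih]; push_cast; ring

@[simp] lemma eval_expandTwo (l : List ℤ) : eval x (expandTwo l) = eval (x ^ 2) l := by
  induction l with
  | nil => rfl
  | cons c l ih => simp only [expandTwo, eval_cons, ih]; push_cast; ring

lemma eval_append (l m : List ℤ) : eval x (l ++ m) = eval x l + x ^ l.length * eval x m := by
  induction l with
  | nil => simp
  | cons c l ih => simp only [List.cons_append, eval_cons, ih, List.length_cons]; ring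

lemma map_eval {S F : Type*} [CommRing S] [FunLike F R S] [RingHomClass F R S] (φ : F)
    (l : List ℤ) : φ (eval x l) = eval (φ x) l := by
  induction l with
  | nil => simp
  | cons c l ih => simp [ih]

lemma eval_eq_zero_of_all {l : List ℤ} (h : l.all (· == 0) = true) : eval x l = 0 := by
  induction l with
  | nil => rfl
  | cons c l ih =>
    simp only [List.all_cons, Bool.and_eq_true, beq_iff_eq] at h
    simp [h.1, ih h.2]

lemma eval_eq_zero_of_divides {p l : List ℤ} (h : divides p l = true) (hp : eval x p = 0) :
    eval x l = 0 := by
  simpa [hp] using eval_eq_zero_of_all x h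

lemma eval_homEval_snd (a b l : List ℤ) : eval x (homEval a b l).2 = eval x b ^ l.length := by
  induction l with
  | nil => simp [homEval]
  | cons c l ih => simp only [homEval, eval_mul, ih, List.length_cons]; ring

lemma eval_homEval_fst {a b : List ℤ} {y : R} (h : eval x b * y = eval x a) (l : List ℤ) :
    eval x (homEval a b l).1 = eval x b ^ l.length * eval y l := by
  induction l with
  | nil => simp [homEval]
  | cons c l ih =>
    simp only [homEval, eval_add, eval_smul, eval_mul, ih, eval_homEval_snd, List.length_cons,
      eval_cons, ← h]
    ring

/-- If `x` is a root of `p` and `p` divides the homogenization of `l` at `a / b`, then the number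
`a x / b x` is a root of `l`. -/
lemma eval_eq_zero_of_divides_homEval [IsDomain R] {p a b l : List ℤ} {y : R}
    (hdvd : divides p (homEval a b l).1 = true) (hp : eval x p = 0) (hb : eval x b ≠ 0)
    (h : eval x b * y = eval x a) : eval y l = 0 := by
  have := eval_eq_zero_of_divides x hdvd hp
  rw [eval_homEval_fst x h] at this
  exact (mul_eq_zero.mp this).resolve_left (pow_ne_zero _ hb)

end CommRing

section Polynomial

open Polynomial

lemma coeff_eval_X (l : List ℤ) (i : ℕ) : (eval (X : ℤ[X]) l).coeff i = l.getD i 0 := by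
  induction l generalizing i with
  | nil => simp
  | cons c l ih =>
    cases i with
    | zero => simp
    | succ i => simp [ih, ← map_intCast (C : ℤ →+* ℤ[X]), -map_intCast, -eq_intCast]

lemma aeval_eval_X {R : Type*} [CommRing R] (x : R) (l : List ℤ) :
    aeval x (eval (X : ℤ[X]) l) = eval x l := by
  rw [map_eval, aeval_X]

lemma natDegree_eval_X {l : List ℤ} {n : ℕ} (hn : l.getD n 0 ≠ 0)
    (hl : ∀ i, n < i → l.getD i 0 = 0) : (eval (X : ℤ[X]) l).natDegree = n := by
  refine natDegree_eq_of_le_of_coeff_ne_zero ?_ (by rwa [coeff_eval_X])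
  exact natDegree_le_iff_coeff_eq_zero.mpr fun i hi => by rw [coeff_eval_X, hl i hi]

lemma dvd_foldr_gcd {r : ℤ} {l : List ℤ} (h : ∀ i, r ∣ l.getD i 0) :
    r ∣ (l.foldr (fun c g => Int.gcd c g) 0 : ℤ) := by
  induction l with
  | nil => simp
  | cons c l ih => exact Int.dvd_coe_gcd (by simpa using h 0) (ih fun i => by simpa using h (i + 1))

lemma isPrimitive_eval_X {l : List ℤ} (h : (l.foldr (fun c g => Int.gcd c g) 0 : ℤ) = 1) :
    (eval (X : ℤ[X]) l).IsPrimitive := by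
  intro r hr
  rw [C_dvd_iff_dvd_coeff] at hr
  exact isUnit_of_dvd_one (h ▸ dvd_foldr_gcd fun i => by simpa [coeff_eval_X] using hr i)

end Polynomial

end CoeffList

/-! ### Irreducibility over a prime field -/

section Irreducible

open Polynomial

/-- Let `f` be a polynomial of degree `2 n` over the field with `p` elements, `n` and `p` being odd
primes, such that `α ^ p ^ n = -α` for all roots `α` of `f`, and `α ^ 2` is not in the prime field.
Then `f` is irreducible. Indeed the degree `d` of each root `α` divides `2 n`. It does not divide
`n`, since this would mean `α = -α`. It does not divide `2`, since otherwise `α ^ 2` would be fixed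
both by the second and by the `n`-th power of the Frobenius map, hence by the map itself. -/
theorem irreducible_of_frobenius_pow_eq_neg {p n : ℕ} [Fact p.Prime] (hp : p ≠ 2)
    (hn : n.Prime) (hn2 : n ≠ 2) {f : (ZMod p)[X]} (hf : f.natDegree = 2 * n)
    (hfrob : ∀ {K : Type} [Field K] [Algebra (ZMod p) K] (α : K), aeval α f = 0 →
      α ^ p ^ n = -α)
    (hsq : ∀ {K : Type} [Field K] [Algebra (ZMod p) K] (α : K) (c : ℤ), aeval α f = 0 →
      α ^ 2 ≠ c) : Irreducible f := by
  have hn0 := hn.pos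
  have hf0 : f ≠ 0 := by rintro rfl; simp at hf; omega
  have hfu : ¬ IsUnit f := fun h => by have := natDegree_eq_zero_of_isUnit h; omega
  obtain ⟨g, hg, hgf⟩ := WfDvdMonoid.exists_irreducible_factor hfu hf0
  have : Fact (Irreducible g) := ⟨hg⟩
  let K := AdjoinRoot g
  have : CharP K p := charP_of_injective_algebraMap (algebraMap (ZMod p) K).injective p
  have hpodd : Odd p := (Fact.out : p.Prime).odd_of_ne_two hp
  let α : K := AdjoinRoot.root g
  have hαg : aeval α g = 0 := (AdjoinRoot.aeval_eq g).trans AdjoinRoot.mk_self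
  have hαf : aeval α f = 0 := by
    obtain ⟨q, rfl⟩ := hgf
    rw [map_mul, hαg, zero_mul]
  have hα0 : α ≠ 0 := fun h => hsq α 0 hαf (by simp [h])
  have h2 : (2 : K) ≠ 0 := by
    intro h
    have : (p : ℕ) ∣ 2 := (CharP.cast_eq_zero_iff K p 2).mp (by exact_mod_cast h)
    exact hp ((Nat.prime_dvd_prime_iff_eq Fact.out Nat.prime_two).mp this)
  have hdeg {k : ℕ} : g.natDegree ∣ k ↔ α ^ p ^ k = α := by
    rw [hg.natDegree_dvd_iff_dvd_X_pow_card_pow_sub_X, Nat.card_zmod,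
      ← hg.dvd_iff_aeval_eq_zero hαg]
    simp [sub_eq_zero]
  have hnα : α ^ p ^ n = -α := hfrob α hαf
  have hd : g.natDegree ∣ 2 * n := by
    rw [hdeg, two_mul, pow_add, pow_mul, hnα, (hpodd.pow).neg_pow, hnα, neg_neg]
  have hdn : ¬ g.natDegree ∣ n := by
    rw [hdeg, hnα, neg_eq_iff_add_eq_zero, ← two_mul]
    exact mul_ne_zero h2 hα0
  have hd2 : ¬ g.natDegree ∣ 2 := by
    rw [hdeg]
    intro h
    have hiter (k : ℕ) (x : K) : (frobenius K p)^[k] x = x ^ p ^ k := by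
      rw [← coe_iterateFrobenius, iterateFrobenius_def]
    have hper2 : Function.IsPeriodicPt (frobenius K p) 2 (α ^ 2) := by
      rw [Function.IsPeriodicPt, Function.IsFixedPt, hiter, pow_right_comm, h]
    have hpern : Function.IsPeriodicPt (frobenius K p) n (α ^ 2) := by
      rw [Function.IsPeriodicPt, Function.IsFixedPt, hiter, pow_right_comm, hnα, neg_sq]
    have hgcd := hper2.gcd hpern
    rw [(Nat.coprime_primes Nat.prime_two hn).mpr hn2.symm, Function.IsPeriodicPt,
      Function.IsFixedPt, hiter, pow_one, ← Subfield.mem_bot_iff_pow_eq_self K p,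
      mem_bot_iff_intCast p] at hgcd
    obtain ⟨c, hc⟩ := hgcd
    exact hsq α c hαf hc.symm
  have hfg : f.natDegree ≤ g.natDegree := by
    rw [hf]
    obtain hcop | ⟨k, hk⟩ := (Nat.coprime_or_dvd_of_prime hn g.natDegree)
    · exact absurd (hcop.symm.dvd_of_dvd_mul_right hd) hd2
    · rw [hk, mul_comm 2, Nat.mul_dvd_mul_iff_left hn0] at hd
      obtain rfl | rfl := (Nat.dvd_prime Nat.prime_two).mp hd
      · exact absurd (by rw [hk, mul_one]) hdn
      · rw [hk, mul_comm]
  exact (associated_of_dvd_of_natDegree_le hgf hf0 hfg).irreducible hg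

/-- A primitive integer polynomial is irreducible if its reduction modulo a prime is irreducible of
the same degree. -/
theorem irreducible_of_irreducible_map_zmod {p : ℕ} [Fact p.Prime] {P : ℤ[X]}
    (hP : P.IsPrimitive) (hlead : (P.leadingCoeff : ZMod p) ≠ 0)
    (h : Irreducible (P.map (Int.castRingHom (ZMod p)))) : Irreducible P := by
  have aux {a b : ℤ[X]} (hab : P = a * b) (hu : IsUnit (a.map (Int.castRingHom (ZMod p)))) :
      IsUnit a := by
    have hla : Int.castRingHom (ZMod p) a.leadingCoeff ≠ 0 := by
      intro h0
      apply hlead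
      rw [hab, leadingCoeff_mul, Int.cast_mul]
      simp only [eq_intCast] at h0
      rw [h0, zero_mul]
    have hdeg := natDegree_map_of_leadingCoeff_ne_zero _ hla
    rw [natDegree_eq_zero_of_isUnit hu] at hdeg
    rw [eq_C_of_natDegree_eq_zero hdeg.symm] at hab ⊢
    exact (hP _ ⟨b, hab⟩).map C
  refine ⟨fun hu => h.not_isUnit (hu.map (mapRingHom _)), fun a b hab => ?_⟩
  have hab' : P = b * a := by rw [hab, mul_comm]
  exact (h.isUnit_or_isUnit (by rw [hab, Polynomial.map_mul])).imp (aux hab) (aux hab')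

/-- An irreducible primitive integer polynomial with positive leading coefficient is the minimal
polynomial of each of its real roots. -/
theorem isMinimalPolynomial_of_irreducible {P : ℤ[X]} {y : ℝ} (hP : P.IsPrimitive)
    (hlead : 0 < P.leadingCoeff) (hirr : Irreducible P) (hroot : aeval y P = 0) :
    IsMinimalPolynomial P y := by
  refine ⟨hP, hlead, hroot, fun Q hQ hQy => ?_⟩
  have hinj : Function.Injective (algebraMap ℤ ℚ) := (algebraMap ℤ ℚ).injective_int
  have hirr' : Irreducible (P.map (algebraMap ℤ ℚ)) :=
    (hP.irreducible_iff_irreducible_map_fraction_map).mp hirr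
  have hdvd : P.map (algebraMap ℤ ℚ) ∣ Q.map (algebraMap ℤ ℚ) := by
    refine (hirr'.dvd_iff_aeval_eq_zero (b := y) ?_).mp ?_ <;> rwa [aeval_map_algebraMap]
  have := natDegree_le_of_dvd hdvd ((Polynomial.map_ne_zero_iff hinj).mpr hQ)
  rwa [natDegree_map_eq_of_injective hinj, natDegree_map_eq_of_injective hinj] at this

end Irreducible

/-! ### Irreducibility of polynomials in `X ^ 2` modulo `31` -/

namespace CoeffList

/-- The product of `l` and `b` modulo the integer `p` and the polynomial `Xⁿ - t`, where `n` is the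
length of `t`. -/
def mulMod (p : ℤ) (t : List ℤ) : List ℤ → List ℤ → List ℤ
  | [], _ => []
  | c :: l, b =>
    let s := add (smul c b) (0 :: mulMod p t l b)
    (add (s.take t.length) (mul (s.drop t.length) t)).map (· % p)

/-- The power of `l` with exponent `2 ^ k - 1` modulo `p` and `Xⁿ - t`. -/
def powMod (p : ℤ) (t l : List ℤ) : ℕ → List ℤ
  | 0 => [1]
  | k + 1 =>
    let s := powMod p t l k
    mulMod p t (mulMod p t s s) l

/-- Iterates of the `p`-th power map on `x`, divided by `x`, as polynomials in `x ^ 2`: modulo the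
prime `p = 2 ^ (m + 1) - 1`, and provided that `x ^ 2` is a root of `Xⁿ - t`, the value of
`frobIter p t m k` at `x ^ 2` is `x ^ (p ^ k - 1)`. -/
def frobIter (p : ℤ) (t : List ℤ) (m : ℕ) : ℕ → List ℤ
  | 0 => [1]
  | k + 1 => mulMod p t (powMod p t (frobIter p t m k) (m + 1)) (powMod p t [0, 1] m)

/-- The polynomial `t` of degree less than `11` such that `X ^ 11 - t` is, modulo `31`, the product
of `l` and `i`. Here `l` has degree `11`, and `i` is inverse to its leading coefficient. -/
def monicTail (i : ℤ) (l : List ℤ) : List ℤ := (l.take 11).map (-i * · % 31)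

section CommRing

variable {R : Type*} [CommRing R] {x : R} {p : ℤ}

lemma eval_map_emod (hp : (p : R) = 0) (l : List ℤ) : eval x (l.map (· % p)) = eval x l := by
  induction l with
  | nil => rfl
  | cons c l ih =>
    have : ((c % p : ℤ) : R) = c := by
      rw [Int.emod_def]
      push_cast
      rw [hp, zero_mul, sub_zero]
    simp [ih, this]

lemma eval_eq_zero_of_all_emod (hp : (p : R) = 0) {l : List ℤ}
    (h : l.all (· % p == 0) = true) : eval x l = 0 := by
  rw [← eval_map_emod hp]
  exact eval_eq_zero_of_all x (by simpa using h)

lemma eval_mulMod (hp : (p : R) = 0) {t : List ℤ} (hx : x ^ t.length = eval x t) (l b : List ℤ) :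
    eval x (mulMod p t l b) = eval x l * eval x b := by
  induction l with
  | nil => simp [mulMod]
  | cons c l ih =>
    have key (s : List ℤ) :
        eval x (add (s.take t.length) (mul (s.drop t.length) t)) = eval x s := by
      conv_rhs => rw [← List.take_append_drop t.length s, eval_append]
      rw [eval_add, eval_mul, ← hx, List.length_take]
      obtain h | h := le_total t.length s.length
      · rw [min_eq_left h, mul_comm (eval x _)]
      · simp [List.drop_eq_nil_of_le h]
    simp only [mulMod, eval_map_emod hp, key, eval_add, eval_smul, eval_cons, ih]
    push_cast
    ring

lemma eval_powMod (hp : (p : R) = 0) {t : List ℤ} (hx : x ^ t.length = eval x t) (l : List ℤ)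
    (k : ℕ) : eval x (powMod p t l k) = eval x l ^ (2 ^ k - 1) := by
  induction k with
  | zero => simp [powMod]
  | succ k ih =>
    have h : 2 ^ (k + 1) - 1 = (2 ^ k - 1) + (2 ^ k - 1) + 1 := by
      have := Nat.one_le_two_pow (n := k)
      omega
    simp only [powMod, eval_mulMod hp hx, ih]
    rw [h, pow_succ, pow_add]

lemma mul_eval_frobIter (hp : (p : R) = 0) {t : List ℤ} (hx : (x ^ 2) ^ t.length = eval (x ^ 2) t)
    (m k : ℕ) : x * eval (x ^ 2) (frobIter p t m k) = x ^ (2 ^ (m + 1) - 1) ^ k := by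
  induction k with
  | zero => simp [frobIter]
  | succ k ih =>
    have h : 2 * (2 ^ m - 1) + 1 = 2 ^ (m + 1) - 1 := by
      have := Nat.one_le_two_pow (n := m)
      omega
    have h' : x * (x ^ 2) ^ (2 ^ m - 1) = x ^ (2 ^ (m + 1) - 1) := by
      rw [← h, pow_succ _ (2 * _), pow_mul, mul_comm]
    rw [frobIter, eval_mulMod hp hx, eval_powMod hp hx, eval_powMod hp hx,
      pow_succ _ k, pow_mul, ← ih, mul_pow, ← h']
    simp only [eval_cons, eval_nil]
    push_cast
    ring

end CommRing

open Polynomial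

lemma eval_X_expandTwo (l : List ℤ) :
    eval (X : ℤ[X]) (expandTwo l) = expand ℤ 2 (eval X l) := by
  rw [eval_expandTwo, map_eval, expand_X]

/-- A criterion for the irreducibility of `l (X ^ 2)` that can be verified by computation. The prime
`31 = 2 ^ 5 - 1` is the one modulo which the polynomials of the vertices are irreducible. -/
theorem irreducible_eval_expandTwo {l : List ℤ} (i : ℤ) (hlen : l.length = 12)
    (hgcd : ((expandTwo l).foldr (fun c g => Int.gcd c g) 0 : ℤ) = 1)
    (hi : i * l.getD 11 0 % 31 = 1)
    (hmonic : (add (smul i l) (monicTail i l ++ [-1])).all (· % 31 == 0) = true)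
    (hfrob : (add (frobIter 31 (monicTail i l) 4 11) [1]).all (· % 31 == 0) = true)
    (hroot : ∀ c ∈ Finset.Ico (0 : ℤ) 31, eval c l % 31 ≠ 0) :
    Irreducible (eval (X : ℤ[X]) (expandTwo l)) := by
  have : Fact (Nat.Prime 31) := ⟨by norm_num⟩
  have hlead0 : (l.getD 11 0 : ZMod 31) ≠ 0 := by
    intro h
    rw [ZMod.intCast_zmod_eq_zero_iff_dvd] at h
    push_cast at h
    rw [Int.mul_emod, Int.emod_eq_zero_of_dvd h] at hi
    simp at hi
  have hdeg : (eval (X : ℤ[X]) l).natDegree = 11 :=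
    natDegree_eval_X (fun h => hlead0 (by rw [h, Int.cast_zero])) fun j hj =>
      List.getD_eq_default _ _ (by omega)
  have hlead : (eval (X : ℤ[X]) (expandTwo l)).leadingCoeff = l.getD 11 0 := by
    rw [eval_X_expandTwo, leadingCoeff_expand two_pos, leadingCoeff, hdeg, coeff_eval_X]
  have haeval {K : Type} [Field K] [Algebra (ZMod 31) K] (α : K) :
      aeval α ((eval (X : ℤ[X]) (expandTwo l)).map (Int.castRingHom (ZMod 31))) =
        eval α (expandTwo l) := by
    rw [← coe_mapRingHom, map_eval, map_eval, coe_mapRingHom, map_X, aeval_X]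
  have h31 {K : Type} [Field K] [Algebra (ZMod 31) K] : ((31 : ℤ) : K) = 0 := by
    have := map_intCast (algebraMap (ZMod 31) K) 31
    rw [← this, show ((31 : ℤ) : ZMod 31) = 0 from rfl, map_zero]
  have hlen' : (monicTail i l).length = 11 := by simp [monicTail, hlen]
  refine irreducible_of_irreducible_map_zmod (p := 31) (isPrimitive_eval_X hgcd)
    (by rwa [hlead]) (irreducible_of_frobenius_pow_eq_neg (p := 31) (n := 11) (by norm_num)
      (by norm_num) (by norm_num) ?_ ?_ ?_)
  · rw [natDegree_map_of_leadingCoeff_ne_zero, eval_X_expandTwo, natDegree_expand, hdeg]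
    rwa [hlead]
  · intro K _ _ α hα
    rw [haeval, eval_expandTwo] at hα
    have hx : (α ^ 2) ^ (monicTail i l).length = eval (α ^ 2) (monicTail i l) := by
      have := eval_eq_zero_of_all_emod (x := α ^ 2) h31 hmonic
      rw [eval_add, eval_smul, hα, eval_append] at this
      simp only [eval_cons, eval_nil] at this
      push_cast at this
      linear_combination -this
    have := eval_eq_zero_of_all_emod (x := α ^ 2) h31 hfrob
    simp only [eval_add, eval_cons, eval_nil] at this
    push_cast at this
    have hiter := mul_eval_frobIter h31 hx 4 11
    norm_num at hiter ⊢
    linear_combination α * this - hiter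
  · intro K _ _ α c hα hc
    rw [haeval, eval_expandTwo, hc] at hα
    have hmem : c % 31 ∈ Finset.Ico (0 : ℤ) 31 :=
      Finset.mem_Ico.mpr ⟨Int.emod_nonneg _ (by norm_num), Int.emod_lt_of_pos _ (by norm_num)⟩
    apply hroot _ hmem
    have hck : ((c % 31 : ℤ) : K) = c := by
      rw [Int.emod_def, Int.cast_sub, Int.cast_mul, h31, zero_mul, sub_zero]
    have : CharP K 31 := charP_of_injective_algebraMap (algebraMap (ZMod 31) K).injective 31
    have hdvd : ((31 : ℕ) : ℤ) ∣ eval (c % 31) l := by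
      rw [← CharP.intCast_eq_zero_iff K 31, ← eq_intCast (Int.castRingHom K), map_eval, eq_intCast,
        hck, hα]
    exact Int.emod_eq_zero_of_dvd hdvd

/-- The criterion `irreducible_eval_expandTwo`, applied to the square of a root of `l`. -/
theorem isMinimalPolynomial_eval {l : List ℤ} (i : ℤ) (hlen : l.length = 12)
    (hgcd : ((expandTwo l).foldr (fun c g => Int.gcd c g) 0 : ℤ) = 1)
    (hpos : 0 < l.getD 11 0)
    (hi : i * l.getD 11 0 % 31 = 1)
    (hmonic : (add (smul i l) (monicTail i l ++ [-1])).all (· % 31 == 0) = true)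
    (hfrob : (add (frobIter 31 (monicTail i l) 4 11) [1]).all (· % 31 == 0) = true)
    (hroot : ∀ c ∈ Finset.Ico (0 : ℤ) 31, eval c l % 31 ≠ 0) {y : ℝ} (hy : eval (y ^ 2) l = 0) :
    IsMinimalPolynomial (eval (X : ℤ[X]) (expandTwo l)) y := by
  have hdeg : (eval (X : ℤ[X]) l).natDegree = 11 :=
    natDegree_eval_X hpos.ne' fun j hj => List.getD_eq_default _ _ (by omega)
  refine isMinimalPolynomial_of_irreducible (isPrimitive_eval_X hgcd) ?_
    (irreducible_eval_expandTwo i hlen hgcd hi hmonic hfrob hroot) ?_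
  · rwa [eval_X_expandTwo, leadingCoeff_expand two_pos, leadingCoeff, hdeg, coeff_eval_X]
  · rw [aeval_eval_X, eval_expandTwo, hy]

end CoeffList
open CoeffList

/-- The coefficients of `polyG` at the even powers. -/
def coeffsG : List ℤ := [
  -912811377667500, 16117998953248125, -36709013218422600, 37940201286814800,
  -23463887481854208, 10021184125203456, -3290335763447808, 888521341648896,
  -192809455583232, 29839017902080, -2742026240000, 109337116672]

/-- The coefficients of `polyH` at the even powers. -/
def coeffsH : List ℤ := [
  -12148787578527675, -123412000423046805, -441020584930952232, 273168911377174014,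
  -27343071784237320, -3667116898760364, 823044986987616, -32095868573376,
  -4779985142784, 615643279360, -27098808320, 427098112]

/-- The coefficients of `polyJ` at the even powers. -/
def coeffsJ : List ℤ := [
  -9964518750000, 570277711828125, -1780552966387500, 849106838377800,
  644904447905880, -102048280254828, -56106534718368, 9027433758528,
  605520976896, -103349145600, -2815229952, 427098112]

lemma polyG_eq : polyG = eval Polynomial.X (expandTwo coeffsG) := by
  simp only [polyG, coeffsG, eval_expandTwo, eval_cons, eval_nil]; push_cast; ring

lemma polyH_eq : polyH = eval Polynomial.X (expandTwo coeffsH) := by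
  simp only [polyH, coeffsH, eval_expandTwo, eval_cons, eval_nil]; push_cast; ring

lemma polyJ_eq : polyJ = eval Polynomial.X (expandTwo coeffsJ) := by
  simp only [polyJ, coeffsJ, eval_expandTwo, eval_cons, eval_nil]; push_cast; ring

theorem isMinimalPolynomial_polyG {y : ℝ} (hy : eval (y ^ 2) coeffsG = 0) :
    IsMinimalPolynomial polyG y := by
  rw [polyG_eq]
  exact isMinimalPolynomial_eval 18 rfl (by decide +kernel) (by decide) (by decide)
    (by decide +kernel) (by decide +kernel)    (by decide +kernel) hy

theorem isMinimalPolynomial_polyH {y : ℝ} (hy : eval (y ^ 2) coeffsH = 0) :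
    IsMinimalPolynomial polyH y := by
  rw [polyH_eq]
  exact isMinimalPolynomial_eval 20 rfl (by decide +kernel) (by decide) (by decide)
    (by decide +kernel) (by decide +kernel)    (by decide +kernel) hy

theorem isMinimalPolynomial_polyJ {y : ℝ} (hy : eval (y ^ 2) coeffsJ = 0) :
    IsMinimalPolynomial polyJ y := by
  rw [polyJ_eq]
  exact isMinimalPolynomial_eval 20 rfl (by decide +kernel) (by decide) (by decide)
    (by decide +kernel) (by decide +kernel)    (by decide +kernel) hy

/-! ### Elimination: the equation for `r` and the coordinates as rational functions of `r` -/

/-- The numerator of `η` as a rational function of `r`. -/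
def etaNum : List ℤ := [297, -90, -885, -1308, -793, -522, -123]

/-- The denominator of `η` as a rational function of `r`. -/
def etaDen : List ℤ := [2592, 7452, 8532, 5736, 2760, 1276, 260]

/-- The polynomial of degree `11` of which `r` is a root. -/
def polyR : List ℤ := [-98415, -229635, 1296891, 6105375, 12289482, 15611778, 14633622, 11029086,
  6803637, 3157585, 945503, 122803]

/-- The elimination of `a` from the equation `3 a ^ 2 + v ^ 2 = 3 + r ^ 2` by means of the linear
equation `Params.mul_w_mul_a` for `a` leads to an equation of degree `4` in `η`. Modulo the equation
for `η ^ 2`, it becomes linear in `η`. -/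
lemma elimination_identity (r η : ℝ) :
    (9 + 12 * r + 7 * r ^ 2) ^ 2 *
      ((-27 + 25 * r + 2 * r ^ 2 + η * (72 + 120 * r + 40 * r ^ 2) +
        η ^ 2 * (108 + 108 * r + 24 * r ^ 2)) ^ 2 -
      192 * ((1 + 2 * r) / 2 + η * (3 + 2 * r)) ^ 2 *
        (3 + r ^ 2 - ((5 - r) / 4 - η * (3 + 5 * r) / 2) ^ 2)) =
    16 * (9 + 12 * r + 7 * r ^ 2) * (eval r etaNum - eval r etaDen * η) +
      ((972 + 2592 * r + 2916 * r ^ 2 + 1584 * r ^ 3 + 336 * r ^ 4) *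
        (4 * (9 + 12 * r + 7 * r ^ 2) * η ^ 2 + (1 - 4 * r - r ^ 2)) +
      4 * (9 + 12 * r + 7 * r ^ 2) * η *
        (648 + 1944 * r + 2592 * r ^ 2 + 1776 * r ^ 3 + 480 * r ^ 4) +
      4 * (9 + 12 * r + 7 * r ^ 2) *
        (-324 + 270 * r + 756 * r ^ 2 + 558 * r ^ 3 + 196 * r ^ 4)) *
      (4 * (9 + 12 * r + 7 * r ^ 2) * η ^ 2 - (1 - 4 * r - r ^ 2)) := by
  simp only [etaNum, etaDen, eval_cons, eval_nil]
  push_cast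
  ring

/-- The elimination of `η` from its linear and its quadratic equation. -/
lemma resultant_identity (r : ℝ) : eval r etaDen ^ 2 * (1 - 4 * r - r ^ 2) -
    4 * (9 + 12 * r + 7 * r ^ 2) * eval r etaNum ^ 2 =
    -4 * ((3 + r ^ 2) * (3 + r) * eval r polyR) := by
  simp only [etaNum, etaDen, polyR, eval_cons, eval_nil]
  push_cast
  ring

/-- The algebraic equations between the parameters of a configuration satisfying `x_H = x_J`. Up to
the factors `√3 β` for abscissas and `β` for ordinates, where `B = (√3 β, β r)`, one has
`F = (r / 2 - (3 + 2 r) η, (3 + 2 r) / 2 + 3 r η)`, `w` is the difference of the abscissas of `D`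
and `F`, `a` is that of the abscissas of `G` and `F`, and `v` that of the ordinates of `G`
and `F`. -/
structure Params (r η a v w : ℝ) : Prop where
  r_nonneg : 0 ≤ r
  η_nonneg : 0 ≤ η
  η_sq : 4 * (9 + 12 * r + 7 * r ^ 2) * η ^ 2 = 1 - 4 * r - r ^ 2
  w_eq : w = (1 + 2 * r) / 2 + η * (3 + 2 * r)
  v_eq : v = (5 - r) / 4 - η * (3 + 5 * r) / 2
  eq_FG : 3 * a ^ 2 + v ^ 2 = 3 + r ^ 2
  eq_DG : 3 * (a - w) ^ 2 + (v - (3 + r / 2 - 3 * r * η)) ^ 2 = 4 * (3 + r ^ 2)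

namespace Params
variable {r η a v w : ℝ}

/-- The difference of the circle equations for `G` is linear in `a`. -/
theorem mul_w_mul_a (h : Params r η a v w) : 24 * w * a = -27 + 25 * r + 2 * r ^ 2 +
    η * (72 + 120 * r + 40 * r ^ 2) + η ^ 2 * (108 + 108 * r + 24 * r ^ 2) := by
  obtain ⟨-, -, -, rfl, rfl, h1, h2⟩ := h
  linear_combination 4 * h1 - 4 * h2

/-- The parameter `η` is a rational function of `r`. -/
theorem eta (h : Params r η a v w) : eval r etaDen * η = eval r etaNum := by
  have hw := h.mul_w_mul_a
  obtain ⟨hr, hη, hq, rfl, rfl, h1, h2⟩ := h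
  have hd : 9 + 12 * r + 7 * r ^ 2 ≠ 0 := by positivity
  apply mul_left_cancel₀ hd
  have := elimination_identity r η
  rw [← hw, hq] at this
  linear_combination (1 / 16) * this -
    12 * (9 + 12 * r + 7 * r ^ 2) ^ 2 * ((1 + 2 * r) / 2 + η * (3 + 2 * r)) ^ 2 * h1

theorem eval_polyR (h : Params r η a v w) : eval r polyR = 0 := by
  have hr := h.r_nonneg
  have hid := resultant_identity r
  rw [← h.eta, ← h.η_sq] at hid
  have key : (3 + r ^ 2) * (3 + r) * eval r polyR = 0 := by linear_combination (1 / 4) * hid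
  exact (mul_eq_zero.mp key).resolve_left (by positivity)

end Params

/-- The numerator of `4 y_G / β` over the denominator `etaDen`. -/
def numG : List ℤ := add (mul [11, 3] etaDen) (mul [-6, 2] etaNum)

/-- The numerator of `2 w` over the denominator `etaDen`. -/
def numW : List ℤ := add (mul [1, 2] etaDen) (mul [6, 4] etaNum)

/-- The numerator of `12 a` over the denominator `numW * etaDen`. -/
def numA : List ℤ := add (mul [-27, 25, 2] (mul etaDen etaDen))
  (add (mul [72, 120, 40] (mul etaDen etaNum)) (mul [108, 108, 24] (mul etaNum etaNum)))

/-- The numerator of `8 y_H / β` over the denominator `numW * etaDen`. -/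
def numH : List ℤ := add (add (mul numW (add numG (mul [18, 6] etaDen)))
  (smul 6 (mul numW numW))) (smul (-1) numA)

/-- The numerator of `8 y_J / β` over the denominator `numW * etaDen`. -/
def numJ : List ℤ := add (mul numW (add numG (add (mul [6, 4] etaDen) (mul [0, 12] etaNum)))) numA

/-- Numerator and denominator of `y_H / β` as a fraction of low degree; it agrees with the
fraction `numH / (8 * numW * etaDen)` modulo `polyR` only. -/
def shortH : List ℤ × List ℤ :=
  ([276710730255, 132789189186, -1011284743239, -1679593923876, -962037004175, -178859634622,
    36341460199], [50417399700, 5354617968, -234151270392, -275633399792, -130855965404])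

/-- Numerator and denominator of `y_J / β` as a fraction of low degree; it agrees with the
fraction `numJ / (8 * numW * etaDen)` modulo `polyR` only. -/
def shortJ : List ℤ × List ℤ :=
  ([337853027025, 1493605880127, 2450570288094, 2238647750082, 1283228143713, 629189410095],
    [421303749903, 1048815508221, 1157827451994, 875989916814, 553867433063, 231428516453])

lemma divides_shortH : divides polyR (add (mul numH shortH.2)
    (smul (-8) (mul (mul numW etaDen) shortH.1))) = true := by
  decide +kernel

lemma divides_shortJ : divides polyR (add (mul numJ shortJ.2)
    (smul (-8) (mul (mul numW etaDen) shortJ.1))) = true := by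
  decide +kernel

lemma divides_homEval_coeffsG : divides polyR (homEval (mul numG numG)
    (mul [3, 0, 1] (mul (smul 4 etaDen) (smul 4 etaDen))) coeffsG).1 = true := by
  decide +kernel

lemma divides_homEval_coeffsH : divides polyR (homEval (mul shortH.1 shortH.1)
    (mul [3, 0, 1] (mul shortH.2 shortH.2)) coeffsH).1 = true := by
  decide +kernel

lemma divides_homEval_coeffsJ : divides polyR (homEval (mul shortJ.1 shortJ.1)
    (mul [3, 0, 1] (mul shortJ.2 shortJ.2)) coeffsJ).1 = true := by
  decide +kernel

namespace Params
variable {r η a v w β : ℝ}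

lemma w_pos (h : Params r η a v w) : 0 < w := by
  have := h.r_nonneg
  have := h.η_nonneg
  rw [h.w_eq]
  positivity

lemma etaDen_pos (h : Params r η a v w) : 0 < eval r etaDen := by
  have := h.r_nonneg
  simp only [etaDen, eval_cons, eval_nil]
  push_cast
  positivity

lemma eval_numW (h : Params r η a v w) : eval r numW = 2 * eval r etaDen * w := by
  rw [numW, eval_add, eval_mul, eval_mul, ← h.eta, h.w_eq]
  simp only [eval_cons, eval_nil]
  push_cast
  ring

lemma eval_numA (h : Params r η a v w) :
    eval r numA = 12 * (eval r numW * eval r etaDen) * a := by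
  rw [h.eval_numW]
  simp only [numA, eval_add, eval_mul, ← h.eta]
  simp only [eval_cons, eval_nil]
  push_cast
  linear_combination (-eval r etaDen ^ 2) * h.mul_w_mul_a

lemma eval_numG (h : Params r η a v w) :
    eval r numG = 4 * eval r etaDen * ((11 + 3 * r) / 4 + η * (r - 3) / 2) := by
  rw [numG, eval_add, eval_mul, eval_mul, ← h.eta]
  simp only [eval_cons, eval_nil]
  push_cast
  ring

/-- If `y / β` is the quotient of the values at `r` of the polynomials `e` and `d`, then `y ^ 2`
is a root of each polynomial `l` such that `polyR` divides the numerator of `l (y ^ 2)`. -/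
lemma eval_sq_eq_zero (h : Params r η a v w) (hβ : β ^ 2 * (3 + r ^ 2) = 1)
    {l d e : List ℤ} (hd : eval r d ≠ 0) {y : ℝ} (hy : eval r d * y = eval r e)
    (hl : divides polyR (homEval (mul e e) (mul [3, 0, 1] (mul d d)) l).1 = true) :
    eval ((β * y) ^ 2) l = 0 := by
  have hκ : eval r [3, 0, 1] = 3 + r ^ 2 := by
    simp only [eval_cons, eval_nil]
    push_cast
    ring
  refine eval_eq_zero_of_divides_homEval r hl h.eval_polyR ?_ ?_
  · simp only [eval_mul, hκ]
    positivity
  · simp only [eval_mul, hκ, ← hy]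
    linear_combination (eval r d * y) ^ 2 * hβ

/-- A fraction equal to `y` may be replaced by one that agrees with it modulo `polyR`. -/
lemma eval_mul_eq_of_divides (h : Params r η a v w) {e d d' : List ℤ} {y : ℝ}
    (hy : 8 * (eval r numW * eval r etaDen) * y = eval r e)
    (hdvd : divides polyR (add (mul e d) (smul (-8) (mul (mul numW etaDen) d'))) = true) :
    eval r d * y = eval r d' := by
  have hW := h.w_pos
  have hE := h.etaDen_pos
  have := eval_eq_zero_of_divides r hdvd h.eval_polyR
  simp only [eval_add, eval_smul, eval_mul, ← hy] at this
  push_cast at this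
  have hne : 8 * (eval r numW * eval r etaDen) ≠ 0 := by rw [h.eval_numW]; positivity
  apply mul_left_cancel₀ hne
  linear_combination this

theorem isMinimalPolynomial_polyG (h : Params r η a v w) (hβ : β ^ 2 * (3 + r ^ 2) = 1) :
    IsMinimalPolynomial polyG (β * ((11 + 3 * r) / 4 + η * (r - 3) / 2)) := by
  have hE := h.etaDen_pos
  refine Harborth.isMinimalPolynomial_polyG
    (h.eval_sq_eq_zero hβ ?_ ?_ divides_homEval_coeffsG) <;> rw [eval_smul] <;> push_cast
  · positivity
  · rw [h.eval_numG]

theorem isMinimalPolynomial_polyH (h : Params r η a v w) (hβ : β ^ 2 * (3 + r ^ 2) = 1) :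
    IsMinimalPolynomial polyH (β * (((11 + 3 * r) / 4 + η * (r - 3) / 2 + (9 + 3 * r) / 2) / 2 +
      3 / 2 * (w - a))) := by
  refine Harborth.isMinimalPolynomial_polyH (h.eval_sq_eq_zero hβ ?_
    (h.eval_mul_eq_of_divides ?_ divides_shortH) divides_homEval_coeffsH)
  · -- The coefficients of the denominator have both signs; it is positive as `r ≤ 1 / 4`.
    have h0 := h.r_nonneg
    have h1 : r ≤ 1 / 4 := by
      have : 0 ≤ 1 - 4 * r - r ^ 2 := by rw [← h.η_sq]; positivity
      nlinarith
    have h2 : r ^ 2 ≤ (1 / 4) ^ 2 := by gcongr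
    have h3 : r ^ 3 ≤ (1 / 4) ^ 3 := by gcongr
    have h4 : r ^ 4 ≤ (1 / 4) ^ 4 := by gcongr
    apply ne_of_gt
    simp only [shortH, eval_cons, eval_nil]
    push_cast
    nlinarith
  · simp only [numH, eval_add, eval_mul, eval_smul, h.eval_numA, h.eval_numG, h.eval_numW]
    simp only [eval_cons, eval_nil]
    push_cast
    ring

theorem isMinimalPolynomial_polyJ (h : Params r η a v w) (hβ : β ^ 2 * (3 + r ^ 2) = 1) :
    IsMinimalPolynomial polyJ (β * (((3 + 2 * r) / 2 + 3 * r * η +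
      ((11 + 3 * r) / 4 + η * (r - 3) / 2)) / 2 + 3 / 2 * a)) := by
  refine Harborth.isMinimalPolynomial_polyJ (h.eval_sq_eq_zero hβ ?_
    (h.eval_mul_eq_of_divides ?_ divides_shortJ) divides_homEval_coeffsJ)
  · have := h.r_nonneg
    simp only [shortJ, eval_cons, eval_nil]
    push_cast
    positivity
  · simp only [numJ, eval_add, eval_mul, h.eval_numA, h.eval_numG, h.eval_numW, ← h.eta]
    simp only [eval_cons, eval_nil]
    push_cast
    ring

end Params

/-! ### Rescaled coordinates -/

/-- The point with abscissa `√3 β ξ` and ordinate `β υ`. In the coordinates `ξ`, `υ` rotations by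
`60°` have rational coefficients. -/
noncomputable def pt (β ξ υ : ℝ) : Plane := !₂[√3 * β * ξ, β * υ]

section pt
variable {β : ℝ}

@[simp] lemma pt_zero (ξ υ : ℝ) : pt β ξ υ 0 = √3 * β * ξ := rfl

@[simp] lemma pt_one (ξ υ : ℝ) : pt β ξ υ 1 = β * υ := rfl

lemma exists_pt (hβ : β ≠ 0) (P : Plane) : ∃ ξ υ, P = pt β ξ υ := by
  have h3 : √3 ≠ 0 := by positivity
  refine ⟨P 0 / (√3 * β), P 1 / β, ?_⟩
  ext i
  fin_cases i
  · simp; field_simp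
  · simp; field_simp

lemma dist_pt {ξ υ ξ' υ' c : ℝ} (hc : 0 ≤ c) : dist (pt β ξ υ) (pt β ξ' υ') = c ↔
    β ^ 2 * (3 * (ξ - ξ') ^ 2 + (υ - υ') ^ 2) = c ^ 2 := by
  have h3 : √3 ^ 2 = 3 := Real.sq_sqrt (by norm_num)
  rw [← sq_eq_sq₀ dist_nonneg hc, EuclideanSpace.dist_sq_eq, Fin.sum_univ_two, Real.dist_eq,
    Real.dist_eq, sq_abs, sq_abs, pt_zero, pt_zero, pt_one, pt_one]
  constructor <;> intro h
  · linear_combination h - β ^ 2 * (ξ - ξ') ^ 2 * h3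
  · linear_combination h + β ^ 2 * (ξ - ξ') ^ 2 * h3

lemma orient_pt (ξ₁ υ₁ ξ₂ υ₂ ξ₃ υ₃ : ℝ) :
    orient (pt β ξ₁ υ₁) (pt β ξ₂ υ₂) (pt β ξ₃ υ₃) =
      √3 * β ^ 2 * ((ξ₂ - ξ₁) * (υ₃ - υ₁) - (υ₂ - υ₁) * (ξ₃ - ξ₁)) := by
  simp only [orient, pt_zero, pt_one]
  ring

lemma orient_pt_nonneg (hβ : β ≠ 0) {ξ₁ υ₁ ξ₂ υ₂ ξ₃ υ₃ : ℝ} :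
    0 ≤ orient (pt β ξ₁ υ₁) (pt β ξ₂ υ₂) (pt β ξ₃ υ₃) ↔
      0 ≤ (ξ₂ - ξ₁) * (υ₃ - υ₁) - (υ₂ - υ₁) * (ξ₃ - ξ₁) := by
  rw [orient_pt]
  exact mul_nonneg_iff_of_pos_left (by positivity)

lemma inner_pt (ξ₁ υ₁ ξ₂ υ₂ ξ₃ υ₃ : ℝ) :
    inner ℝ (pt β ξ₁ υ₁ - pt β ξ₂ υ₂) (pt β ξ₃ υ₃ - pt β ξ₂ υ₂) =
      β ^ 2 * (3 * (ξ₁ - ξ₂) * (ξ₃ - ξ₂) + (υ₁ - υ₂) * (υ₃ - υ₂)) := by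
  have h3 : √3 ^ 2 = 3 := Real.sq_sqrt (by norm_num)
  simp only [PiLp.inner_apply, Fin.sum_univ_two, PiLp.sub_apply, pt_zero, pt_one,
    RCLike.inner_apply, conj_trivial]
  linear_combination β ^ 2 * (ξ₁ - ξ₂) * (ξ₃ - ξ₂) * h3

end pt

/-- The vector `(x, y)` of squared norm `q ^ 2 (3 + r ^ 2)` is determined by its scalar product
`p (3 + r ^ 2)` with `(1, -r)`, if it lies to the left of this vector. -/
lemma eq_of_inner_eq {r x y p z : ℝ} (hz : 0 < z)
    (hnorm : 3 * x ^ 2 + y ^ 2 = (p ^ 2 + 3 * z ^ 2) * (3 + r ^ 2))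
    (hinner : 3 * x - r * y = p * (3 + r ^ 2)) (hleft : 0 ≤ y + r * x) :
    x = p + r * z ∧ y = 3 * z - p * r := by
  have hκ : 0 < 3 + r ^ 2 := by positivity
  have h : y + r * x = z * (3 + r ^ 2) := by
    rw [← sq_eq_sq₀ hleft (by positivity)]
    linear_combination (1 / 3) * (3 + r ^ 2) * hnorm -
      (1 / 3) * (3 * x - r * y + p * (3 + r ^ 2)) * hinner
  constructor <;> apply mul_left_cancel₀ hκ.ne'
  · linear_combination hinner + r * h
  · linear_combination 3 * h - r * hinner

/-- The third vertex of an equilateral triangle is obtained by rotating a side by `60°`. -/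
lemma eq_rotate_of_equilateral {x y p q s : ℝ} (hs : 0 < s) (h1 : 3 * x ^ 2 + y ^ 2 = s)
    (h2 : 3 * p ^ 2 + q ^ 2 = s) (h3 : 3 * (p - x) ^ 2 + (q - y) ^ 2 = s)
    (hleft : 0 ≤ x * q - y * p) : p = (x - y) / 2 ∧ q = (3 * x + y) / 2 := by
  have hin : 3 * x * p + y * q = s / 2 := by linear_combination (h1 + h2 - h3) / 2
  have h : x * q - y * p = s / 2 := by
    rw [← sq_eq_sq₀ hleft (by positivity)]
    linear_combination (1 / 3) * (3 * p ^ 2 + q ^ 2) * h1 + (1 / 3) * s * h2 -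
      (1 / 3) * (3 * x * p + y * q + s / 2) * hin
  constructor <;> apply mul_left_cancel₀ hs.ne'
  · linear_combination -p * h1 + x * hin - y * h
  · linear_combination -q * h1 + y * hin + 3 * x * h

variable {A B C D E F G H J : Plane}

/-- The choice of the scale: `β` is `x_B / √3`, and `r` is `y_B / β`. -/
lemma IsConfiguration.exists_scale (h : IsConfiguration A B C D E F G H J) :
    ∃ β r : ℝ, 0 < β ∧ 0 ≤ r ∧ β ^ 2 * (3 + r ^ 2) = 1 ∧ B = pt β 1 r ∧ C = pt β 2 0 := by
  have h3 : √3 ^ 2 = 3 := Real.sq_sqrt (by norm_num)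
  have h3' : 0 < √3 := by positivity
  have hAB : B 0 ^ 2 + B 1 ^ 2 = 1 := by
    have := h.side_AB
    rw [← sq_eq_sq₀ dist_nonneg zero_le_one, h.origin, EuclideanSpace.dist_sq_eq,
      Fin.sum_univ_two, Real.dist_eq, Real.dist_eq, sq_abs, sq_abs] at this
    simpa using this
  have hBC : (B 0 - C 0) ^ 2 + B 1 ^ 2 = 1 := by
    have := h.side_BC
    rw [← sq_eq_sq₀ dist_nonneg zero_le_one, EuclideanSpace.dist_sq_eq,
      Fin.sum_univ_two, Real.dist_eq, Real.dist_eq, sq_abs, sq_abs, h.axis] at this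
    simpa using this
  have hC : C 0 = 2 * B 0 := by
    apply mul_left_cancel₀ h.axis_pos.ne'
    linear_combination hBC - hAB
  have hB : 0 < B 0 := by linarith [h.axis_pos]
  refine ⟨B 0 / √3, B 1 / (B 0 / √3), by positivity, div_nonneg h.height (by positivity),
    ?_, ?_, ?_⟩
  · field_simp
    rw [h3]; linear_combination 3 * hAB
  · ext i
    fin_cases i <;> simp <;> field_simp
  · ext i
    fin_cases i
    · simp [hC]; field_simp
    · simp [h.axis]

/-- A configuration with `x_H = x_J` gives a solution of the equations between the parameters, and
the ordinates of `G`, `H`, `J` are expressed by it. The vertices are determined successively, the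
orientations selecting one of two intersection points; for `G` no selection is needed. -/
theorem IsHarborth.exists_params (h : IsHarborth A B C D E F G H J) :
    ∃ β r η a v w : ℝ, β ^ 2 * (3 + r ^ 2) = 1 ∧ Params r η a v w ∧
      G 1 = β * ((11 + 3 * r) / 4 + η * (r - 3) / 2) ∧
      H 1 = β * (((11 + 3 * r) / 4 + η * (r - 3) / 2 + (9 + 3 * r) / 2) / 2 + 3 / 2 * (w - a)) ∧
      J 1 = β * (((3 + 2 * r) / 2 + 3 * r * η +
        ((11 + 3 * r) / 4 + η * (r - 3) / 2)) / 2 + 3 / 2 * a) := by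
  obtain ⟨β, r, hβ, hr, hβκ, rfl, rfl⟩ := h.exists_scale
  have hβ0 := hβ.ne'
  obtain ⟨d₁, d₂, rfl⟩ := exists_pt hβ0 D
  obtain ⟨e₁, e₂, rfl⟩ := exists_pt hβ0 E
  obtain ⟨f, k, rfl⟩ := exists_pt hβ0 F
  obtain ⟨g, m, rfl⟩ := exists_pt hβ0 G
  obtain ⟨ξH, υH, rfl⟩ := exists_pt hβ0 H
  obtain ⟨ξJ, υJ, rfl⟩ := exists_pt hβ0 J
  obtain rfl : A = pt β 0 0 := by
    rw [h.origin]
    ext i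
    fin_cases i <;> simp
  have hκ : 0 < 3 + r ^ 2 := by positivity
  have scale {X c : ℝ} (hX : β ^ 2 * X = c) : X = c * (3 + r ^ 2) := by
    linear_combination (3 + r ^ 2) * hX - X * hβκ
  have scale_dist {ξ υ ξ' υ' c : ℝ} (hc : 0 ≤ c) (hd : dist (pt β ξ υ) (pt β ξ' υ') = c) :
      3 * (ξ - ξ') ^ 2 + (υ - υ') ^ 2 = c ^ 2 * (3 + r ^ 2) := scale ((dist_pt hc).mp hd)
  -- The trapezoid.
  have hCD := scale_dist (by norm_num) h.side_CD
  have hC := h.angle_C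
  rw [inner_pt] at hC
  replace hC := scale hC
  have hBCD := (orient_pt_nonneg hβ0).mp h.trapezoid.1
  obtain ⟨hd₁, hd₂⟩ := eq_of_inner_eq (r := r) (x := d₁ - 2) (y := d₂) (p := -3 / 2) (z := 3 / 2)
    (by norm_num) (by linear_combination hCD) (by linear_combination -hC)
    (by linear_combination hBCD)
  obtain rfl : d₁ = (1 + 3 * r) / 2 := by linear_combination hd₁
  obtain rfl : d₂ = (9 + 3 * r) / 2 := by linear_combination hd₂
  have hBE := scale_dist (by norm_num) h.side_BE
  have hB := h.angle_B
  rw [inner_pt] at hB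
  replace hB := scale hB
  have hEBC := (orient_pt_nonneg hβ0).mp h.trapezoid.2.2.2
  obtain ⟨he₁, he₂⟩ := eq_of_inner_eq (r := r) (x := e₁ - 1) (y := e₂ - r) (p := -1) (z := 1)
    (by norm_num) (by linear_combination hBE) (by linear_combination hB)
    (by linear_combination hEBC)
  obtain rfl : r = e₁ := by linear_combination -he₁
  obtain rfl : e₂ = 3 + 2 * r := by linear_combination he₂
  -- The vertex `F`, on the bisector of `A E`.
  have hFA := scale_dist zero_le_one h.mem_F.1
  have hFE := scale_dist zero_le_one h.mem_F.2
  have hEFA := (orient_pt_nonneg hβ0).mp h.side_F.2.2.1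
  have hd : 0 < 9 + 12 * r + 7 * r ^ 2 := by positivity
  obtain ⟨η, hη⟩ : ∃ η, (9 + 12 * r + 7 * r ^ 2) * η = r * k - (3 + 2 * r) * f :=
    ⟨_, mul_div_cancel₀ _ hd.ne'⟩
  have hη0 : 0 ≤ η := nonneg_of_mul_nonneg_right (by rw [hη]; linear_combination hEFA) hd
  obtain rfl : f = r / 2 - (3 + 2 * r) * η := by
    apply mul_left_cancel₀ hd.ne'
    linear_combination (r / 2) * (hFA - hFE) + (3 + 2 * r) * hη
  obtain rfl : k = (3 + 2 * r) / 2 + 3 * r * η := by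
    apply mul_left_cancel₀ hd.ne'
    linear_combination ((3 + 2 * r) / 2) * (hFA - hFE) - 3 * r * hη
  -- The vertex `G` and the equilateral triangles over `G D` and `F G`.
  have hGF := scale_dist zero_le_one h.mem_G.1
  have hGD := scale_dist zero_le_two h.mem_G.2
  have hHD := scale_dist zero_le_two h.mem_H.1
  have hHG := scale_dist zero_le_two h.mem_H.2
  have hGDH := (orient_pt_nonneg hβ0).mp h.side_H
  obtain ⟨hH₁, hH₂⟩ := eq_rotate_of_equilateral (s := 4 * (3 + r ^ 2)) (by positivity)
    (by linear_combination hGD) (by linear_combination hHG) (by linear_combination hHD) hGDH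
  have hJF := scale_dist zero_le_one h.mem_J.1
  have hJG := scale_dist zero_le_one h.mem_J.2
  have hFGJ := (orient_pt_nonneg hβ0).mp h.side_J
  obtain ⟨hJ₁, hJ₂⟩ := eq_rotate_of_equilateral hκ
    (by linear_combination hGF) (by linear_combination hJF) (by linear_combination hJG) hFGJ
  -- In terms of the rotated vectors the condition `x_H = x_J` is linear and involves only the
  -- ordinate of `G`, its abscissa cancelling.
  have hperp : ξH = ξJ := mul_left_cancel₀ (by positivity : √3 * β ≠ 0) h.perp
  obtain rfl : m = (11 + 3 * r) / 4 + η * (r - 3) / 2 := by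
    linear_combination hperp - hH₁ + hJ₁
  refine ⟨β, r, η, g - (r / 2 - (3 + 2 * r) * η), _, _, hβκ, ⟨hr, hη0, ?_, rfl, rfl, ?_, ?_⟩, rfl,
    ?_, ?_⟩
  · linear_combination 4 / 3 * hFA
  · linear_combination hGF
  · linear_combination hGD
  · rw [pt_one]
    linear_combination β * hH₂
  · rw [pt_one]
    linear_combination β * hJ₂

/-! ### Existence -/

lemma continuous_eval (l : List ℤ) : Continuous fun x : ℝ => eval x l := by
  induction l with
  | nil => exact continuous_const
  | cons c l ih => exact continuous_const.add (continuous_id.mul ih)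

lemma exists_root_polyR : ∃ r : ℝ, 1 / 5 ≤ r ∧ r ≤ 11 / 50 ∧ eval r polyR = 0 := by
  have h0 : (0 : ℝ) ∈ Set.Icc (eval (1 / 5 : ℝ) polyR) (eval (11 / 50 : ℝ) polyR) := by
    constructor <;> norm_num [polyR]
  obtain ⟨r, hr, h⟩ := intermediate_value_Icc (by norm_num) (continuous_eval polyR).continuousOn h0
  exact ⟨r, hr.1, hr.2, h⟩

/-- The equations between the parameters can be solved, with signs that give the points the
required positions. -/
theorem exists_params :
    ∃ r η a v w : ℝ, Params r η a v w ∧ r ≤ 11 / 50 ∧ η ≤ 1 / 6 ∧ a ≤ 0 ∧ 0 ≤ v := by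
  obtain ⟨r, hr1, hr2, hr⟩ := exists_root_polyR
  have hr0 : 0 ≤ r := by linarith
  have hden : 0 < eval r etaDen := by
    simp only [etaDen, eval_cons, eval_nil]
    push_cast
    positivity
  have hnum : 0 ≤ eval r etaNum := by
    have h2 : r ^ 2 ≤ (11 / 50) ^ 2 := by gcongr
    have h3 : r ^ 3 ≤ (11 / 50) ^ 3 := by gcongr
    have h4 : r ^ 4 ≤ (11 / 50) ^ 4 := by gcongr
    have h5 : r ^ 5 ≤ (11 / 50) ^ 5 := by gcongr
    have h6 : r ^ 6 ≤ (11 / 50) ^ 6 := by gcongr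
    simp only [etaNum, eval_cons, eval_nil]
    push_cast
    linarith
  obtain ⟨η, hη⟩ : ∃ η, eval r etaDen * η = eval r etaNum := ⟨_, mul_div_cancel₀ _ hden.ne'⟩
  have hη0 : 0 ≤ η := nonneg_of_mul_nonneg_right (by rwa [hη]) hden
  have hsq : 4 * (9 + 12 * r + 7 * r ^ 2) * η ^ 2 = 1 - 4 * r - r ^ 2 := by
    have := resultant_identity r
    rw [← hη, hr] at this
    apply mul_left_cancel₀ (pow_ne_zero 2 hden.ne')
    linear_combination -this
  have hη1 : η ≤ 1 / 6 := by
    apply le_of_sq_le_sq _ (by norm_num)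
    nlinarith [mul_nonneg hr0 (sq_nonneg η), mul_nonneg (sq_nonneg r) (sq_nonneg η)]
  have hw : 0 < (1 + 2 * r) / 2 + η * (3 + 2 * r) := by positivity
  obtain ⟨a, ha⟩ : ∃ a, 24 * ((1 + 2 * r) / 2 + η * (3 + 2 * r)) * a =
      -27 + 25 * r + 2 * r ^ 2 + η * (72 + 120 * r + 40 * r ^ 2) +
        η ^ 2 * (108 + 108 * r + 24 * r ^ 2) := ⟨_, mul_div_cancel₀ _ (by positivity)⟩
  have hFG : 3 * a ^ 2 + ((5 - r) / 4 - η * (3 + 5 * r) / 2) ^ 2 = 3 + r ^ 2 := by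
    have := elimination_identity r η
    rw [← ha, hη, hsq] at this
    have hd : (9 + 12 * r + 7 * r ^ 2) ^ 2 * ((1 + 2 * r) / 2 + η * (3 + 2 * r)) ^ 2 ≠ 0 := by
      positivity
    apply mul_left_cancel₀ hd
    linear_combination (1 / 192) * this
  refine ⟨r, η, a, _, _, ⟨hr0, hη0, hsq, rfl, rfl, hFG, ?_⟩, hr2, hη1, ?_, ?_⟩
  · linear_combination hFG - (1 / 4) * ha
  · refine nonpos_of_mul_nonpos_right (a := 24 * ((1 + 2 * r) / 2 + η * (3 + 2 * r))) ?_
      (by positivity)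
    rw [ha]
    -- The right-hand side increases with `r` and `η`, and is negative at their upper bounds.
    calc _ ≤ -27 + 25 * (11 / 50) + 2 * (11 / 50) ^ 2 +
          1 / 6 * (72 + 120 * (11 / 50) + 40 * (11 / 50) ^ 2) +
          (1 / 6) ^ 2 * (108 + 108 * (11 / 50) + 24 * (11 / 50 : ℝ) ^ 2) := by gcongr
      _ ≤ 0 := by norm_num
  · nlinarith

theorem exists_isHarborth : ∃ A B C D E F G H J : Plane, IsHarborth A B C D E F G H J := by
  obtain ⟨r, η, a, v, w, h, hr, hη, ha, hv⟩ := exists_params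
  have hw := h.w_pos
  obtain ⟨hr0, hη0, hsq, rfl, rfl, hFG, hDG⟩ := h
  have hκ : 0 < 3 + r ^ 2 := by positivity
  obtain ⟨β, hβ, hβκ⟩ : ∃ β : ℝ, 0 < β ∧ β ^ 2 * (3 + r ^ 2) = 1 :=
    ⟨(√(3 + r ^ 2))⁻¹, by positivity, by
      rw [inv_pow, Real.sq_sqrt hκ.le, inv_mul_cancel₀ hκ.ne']⟩
  have hβ0 := hβ.ne'
  have scale {X c : ℝ} (hX : X = c * (3 + r ^ 2)) : β ^ 2 * X = c := by
    linear_combination β ^ 2 * hX + c * hβκ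
  have scale_dist {ξ υ ξ' υ' c : ℝ} (hc : 0 ≤ c)
      (hd : 3 * (ξ - ξ') ^ 2 + (υ - υ') ^ 2 = c ^ 2 * (3 + r ^ 2)) :
      dist (pt β ξ υ) (pt β ξ' υ') = c := (dist_pt hc).mpr (scale hd)
  let f : ℝ := r / 2 - (3 + 2 * r) * η
  let k : ℝ := (3 + 2 * r) / 2 + 3 * r * η
  let m : ℝ := (11 + 3 * r) / 4 + η * (r - 3) / 2
  let x : ℝ := (1 + 3 * r) / 2 - (f + a)
  let y : ℝ := (9 + 3 * r) / 2 - m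
  refine ⟨pt β 0 0, pt β 1 r, pt β 2 0, pt β ((1 + 3 * r) / 2) ((9 + 3 * r) / 2),
    pt β r (3 + 2 * r), pt β f k, pt β (f + a) m,
    pt β (f + a + (x - y) / 2) (m + (3 * x + y) / 2),
    pt β (f + (a - (m - k)) / 2) (k + (3 * a + (m - k)) / 2),
    { origin := by ext i; fin_cases i <;> simp
      axis := by simp
      axis_pos := by simpa using hβ
      height := by rw [pt_one]; positivity
      side_AB := scale_dist zero_le_one (by ring)
      side_BC := scale_dist zero_le_one (by ring)
      side_CD := scale_dist zero_le_three (by ring)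
      angle_C := by rw [inner_pt]; exact scale (by ring)
      side_BE := scale_dist zero_le_two (by ring)
      angle_B := by rw [inner_pt]; exact scale (by ring)
      trapezoid := ?_
      mem_F := ⟨scale_dist zero_le_one ?_, scale_dist zero_le_one ?_⟩
      side_F := ?_
      mem_G := ⟨scale_dist zero_le_one ?_, scale_dist zero_le_two ?_⟩
      side_G := ?_
      mem_H := ⟨scale_dist zero_le_two ?_, scale_dist zero_le_two ?_⟩
      side_H := ?_
      mem_J := ⟨scale_dist zero_le_one ?_, scale_dist zero_le_one ?_⟩
      side_J := ?_
      perp := ?_ }⟩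
  · simp only [IsConvexQuadrangle, orient_pt_nonneg hβ0]
    refine ⟨?_, ?_, ?_, ?_⟩ <;> ring_nf <;> positivity
  · simp only [f, k]; linear_combination (3 / 4) * hsq
  · simp only [f, k]; linear_combination (3 / 4) * hsq
  · simp only [IsConvexQuadrangle, orient_pt_nonneg hβ0, f, k]
    refine ⟨?_, ?_, ?_, ?_⟩
    · nlinarith
    · nlinarith [mul_nonneg hr0 hη0]
    · ring_nf; positivity
    · nlinarith [mul_nonneg hr0 hη0, mul_nonneg (mul_nonneg hr0 hr0) hη0]
  · simp only [f, k, m]; linear_combination hFG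
  · simp only [f, m]; linear_combination hDG
  · rw [orient_pt_nonneg hβ0]
    have hu : 0 ≤ 3 + r / 2 - 3 * r * η := by nlinarith
    have := add_nonneg (mul_nonneg hw.le hv) (mul_nonneg hu (neg_nonneg.mpr ha))
    simp only [f, k, m]
    linear_combination this
  · simp only [x, y, f, m]; linear_combination hDG
  · simp only [x, y, f, m]; linear_combination hDG
  · rw [orient_pt_nonneg hβ0]
    simp only [x, y, f, m]
    linear_combination 2 * hκ - (1 / 2) * hDG
  · simp only [f, k, m]; linear_combination hFG
  · simp only [f, k, m]; linear_combination hFG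
  · rw [orient_pt_nonneg hβ0]
    simp only [f, k, m]
    linear_combination (1 / 2) * hκ - (1 / 2) * hFG
  · simp only [pt_zero, x, y, f, k, m]
    ring

end Harborth

theorem mainTheorem4 :
    (∃ A B C D E F G H J : Harborth.Plane, Harborth.IsHarborth A B C D E F G H J) ∧
    ∀ A B C D E F G H J : Harborth.Plane, Harborth.IsHarborth A B C D E F G H J →
      Harborth.IsMinimalPolynomial Harborth.polyG (G 1) ∧
      Harborth.IsMinimalPolynomial Harborth.polyH (H 1) ∧
      Harborth.IsMinimalPolynomial Harborth.polyJ (J 1) := by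
  refine ⟨Harborth.exists_isHarborth, fun A B C D E F G H J h => ?_⟩
  obtain ⟨β, r, η, a, v, w, hβ, hp, hG, hH, hJ⟩ := h.exists_params
  rw [hG, hH, hJ]
  exact ⟨hp.isMinimalPolynomial_polyG hβ, hp.isMinimalPolynomial_polyH hβ,
    hp.isMinimalPolynomial_polyJ hβ⟩
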